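/- Let $n\ge 2$ and $q\ge 2$ be integers, and let $P(x)=a_nx^n+\cdots+a_1x+a_0\in\mathbb{Z}[x]$ be a polynomial of degree $n$ with $\gcd(a_n,\dots,a_0,q)=1$. Let $I\subseteq\mathbb{R}$ be an interval of length at most $q^{1/n}$. Then the number $W$ of integers $x\in I$ with $P(x)\equiv 0\pmod q$ is finite and satisfies $$W\le 2(n-1)^2\,\omega(q),$$ where $\omega(q)$ denotes the number of distinct prime divisors of $q$. -/

import Mathlib

/-!
Fix a prime `p ∣ q`, let `k` be the exponent of `p` in `q`, and let `v(x, x')` be the `p`-adic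
valuation of `x - x'`, capped at `k` (`cappedVal`). Newton interpolation along a sequence of
solutions chosen greedily for `p` shows that there are solutions `y₁, …, yₙ` with
`∑ᵢ v(x, yᵢ) ≥ k` for every solution `x` (`exists_prod_sub_dvd`, `le_sum_cappedVal`). As `v` is
ultrametric, the solutions can then be labelled by the `yᵢ` so that `v(x, x')` is at least a kernel
`H` evaluated at the labels of `x` and `x'`, where `H` is a truncation of `v` that is positive
semidefinite and has all row sums equal to `k`. Hence `αᵀ H α ≥ k (∑ αᵢ)² / n` for all real `α`
(`exists_label_of_le_sum`, `sum_sq_le_sum_truncated`).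

If there are more than `(n - 1) ω(q) + 1` solutions, linear algebra gives a nonzero real function `c`
on them whose sums over all label classes, for all primes `p ∣ q`, vanish
(`exists_ne_zero_fiber_sums_eq_zero`). Write `c = a - b` with positive part `a` and negative part `b`,
which have the same class sums and the same total `A > 0`. For each `p` the inequality for `H` gives
`∑ a(x) b(x') v(x, x') ≥ k A² / n`. Multiplying by `log p` and summing over `p` gives
`∑ a(x) b(x') log gcd(q, x - x') ≥ A² log q / n`. This is impossible if all differences are smaller
than `q ^ (1 / n)`, since the disjoint supports of `a` and `b` force `x ≠ x'` in the nonzero terms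
(`card_le_of_pow_abs_sub_lt`).

An interval of length exactly `q ^ (1 / n)` costs at most one more solution, so the count is at most
`(n - 1) ω(q) + 2`. That is at most `2 (n - 1)² ω(q)` unless `n = 2` and `ω(q) = 1`, a case settled
directly from `exists_prod_sub_dvd` (`card_le_two_of_natDegree_le_two`).
-/

open Finset

/-! ### Newton interpolation modulo a prime power -/

/-- If `N * Q` vanishes modulo `p ^ k` on `X` and `Q` has degree at most `d` and is nonzero
modulo `p`, then there are `d` points of `X` whose linear factors can replace `Q`. With `N = 1`,
the solutions of `Q ≡ 0` modulo `p ^ k` are seen to be no worse than those of a product of `d`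
linear factors. The points form a Newton interpolation sequence in which each point makes the
`p`-adic valuation of the preceding product minimal; the factor `N` is that preceding product. -/
theorem exists_prod_sub_dvd {p : ℕ} (hp : p.Prime) (k : ℕ) {X : Finset ℤ} (hX : X.Nonempty)
    (d : ℕ) : ∀ (N : ℤ → ℤ) (Q : Polynomial ℤ), Q.natDegree ≤ d →
    (∃ j, ¬ (p : ℤ) ∣ Q.coeff j) → (∀ x ∈ X, (p : ℤ) ^ k ∣ N x * Q.eval x) →
    ∃ y : Fin d → ℤ, (∀ i, y i ∈ X) ∧ ∀ x ∈ X, (p : ℤ) ^ k ∣ N x * ∏ i, (x - y i) := by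
  have hpZ : Prime (p : ℤ) := Nat.prime_iff_prime_int.mp hp
  induction d with
  | zero =>
    intro N Q hdeg ⟨j, hj⟩ hdvd
    obtain ⟨c, rfl⟩ : ∃ c, Q = Polynomial.C c :=
      ⟨_, Polynomial.eq_C_of_natDegree_le_zero hdeg⟩
    have hc : ¬ (p : ℤ) ∣ c := by
      rintro hc
      rw [Polynomial.coeff_C] at hj
      split_ifs at hj <;> simp_all
    refine ⟨Fin.elim0, fun i => i.elim0, fun x hx => ?_⟩
    have h := hdvd x hx
    rw [Polynomial.eval_C] at h
    simpa using hpZ.pow_dvd_of_dvd_mul_right k hc h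
  | succ d ih =>
    intro N Q hdeg ⟨j, hj⟩ hdvd
    obtain ⟨y, hy, hmin⟩ := X.exists_min_image (fun x => Int.gcd (N x) ((p : ℤ) ^ k)) hX
    have hpow (x : ℤ) : ∃ j ≤ k, Int.gcd (N x) ((p : ℤ) ^ k) = p ^ j := by
      apply (Nat.dvd_prime_pow hp).mp
      have := Int.gcd_dvd_right (a := N x) (b := (p : ℤ) ^ k)
      exact_mod_cast this
    have hgdvd (x : ℤ) (hx : x ∈ X) :
        (Int.gcd (N y) ((p : ℤ) ^ k) : ℤ) ∣ N x := by
      refine dvd_trans ?_ (Int.gcd_dvd_left (a := N x) (b := (p : ℤ) ^ k))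
      have h := hmin x hx
      obtain ⟨a, -, ha⟩ := hpow y
      obtain ⟨b, -, hb⟩ := hpow x
      rw [ha, hb] at h ⊢
      have := (Nat.pow_le_pow_iff_right hp.one_lt).mp h
      exact_mod_cast pow_dvd_pow p this
    by_cases hNy : (p : ℤ) ^ k ∣ N y
    · refine ⟨fun _ => y, fun _ => hy, fun x hx => Dvd.dvd.mul_right ?_ _⟩
      exact (Int.dvd_coe_gcd hNy dvd_rfl).trans (hgdvd x hx)
    -- The minimality of `N y` lets the remainder `Q.eval y` be dropped: it is divisible by `p`, and
    -- its product with any `N x` is divisible by `p ^ k`.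
    · have hc : (p : ℤ) ∣ Q.eval y := by
        by_contra hc
        exact hNy (hpZ.pow_dvd_of_dvd_mul_right k hc (hdvd y hy))
      have hNc (x : ℤ) (hx : x ∈ X) : (p : ℤ) ^ k ∣ N x * Q.eval y := by
        refine dvd_trans ?_ (mul_dvd_mul_right (hgdvd x hx) _)
        have h := Int.dvd_coe_gcd (hdvd y hy) (dvd_mul_right ((p : ℤ) ^ k) (Q.eval y))
        rw [Int.gcd_mul_right] at h
        push_cast at h
        rwa [← Int.dvd_natAbs, Int.natAbs_mul, Int.natAbs_natCast, Nat.cast_mul,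
          Int.natCast_natAbs]
      set R := Q /ₘ (Polynomial.X - Polynomial.C y) with hR
      have hQ : Q = (Polynomial.X - Polynomial.C y) * R + Polynomial.C (Q.eval y) := by
        rw [hR, Polynomial.X_sub_C_mul_divByMonic_eq_sub_modByMonic,
          Polynomial.modByMonic_X_sub_C_eq_C_eval]
        ring
      have hRcoeff : ∃ j, ¬ (p : ℤ) ∣ R.coeff j := by
        by_contra! hall
        apply hj
        have h1 : Polynomial.C (p : ℤ) ∣ R := (Polynomial.C_dvd_iff_dvd_coeff _ _).mpr hall
        have h2 : Polynomial.C (p : ℤ) ∣ Q := by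
          rw [hQ]
          exact dvd_add (h1.mul_left _) (map_dvd Polynomial.C hc)
        exact (Polynomial.C_dvd_iff_dvd_coeff _ _).mp h2 j
      have hRdeg : R.natDegree ≤ d := by
        rw [hR, Polynomial.natDegree_divByMonic _ (Polynomial.monic_X_sub_C y),
          Polynomial.natDegree_X_sub_C]
        omega
      obtain ⟨z, hz, hzdvd⟩ := ih (fun x => N x * (x - y)) R hRdeg hRcoeff (by
        intro x hx
        have hx' : Q.eval x = (x - y) * R.eval x + Q.eval y := by
          conv_lhs => rw [hQ]
          simp
        have he : N x * (x - y) * R.eval x = N x * Q.eval x - N x * Q.eval y := by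
          rw [hx']
          ring
        rw [he]
        exact dvd_sub (hdvd x hx) (hNc x hx))
      refine ⟨Fin.cons y z, fun i => ?_, fun x hx => ?_⟩
      · refine Fin.cases ?_ ?_ i
        · simpa using hy
        · simpa using hz
      · rw [Fin.prod_univ_succ]
        simpa [mul_assoc] using hzdvd x hx

/-! ### Positivity of ultrametric kernels -/

/-- The indicator of a symmetric and transitive relation is a positive semidefinite kernel. -/
theorem sum_mul_indicator_nonneg {ι : Type*} [Fintype ι] (r : ι → ι → Prop)
    (hsymm : ∀ i j, r i j → r j i) (htrans : ∀ i j l, r i j → r j l → r i l) (α : ι → ℝ)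
    [DecidableRel r] :
    0 ≤ ∑ i, ∑ j, α i * α j * (if r i j then 1 else 0) := by
  classical
  -- The finset `T` runs over the possible classes of `r`.
  have key (i j : ι) : (if r i j then (1 : ℝ) else 0) = ∑ T : Finset ι,
      (if r i i ∧ univ.filter (r i) = T then 1 else 0) *
      (if r j j ∧ univ.filter (r j) = T then 1 else 0) := by
    by_cases h : r i j
    · have hii := htrans _ _ _ h (hsymm _ _ h)
      have hjj := htrans _ _ _ (hsymm _ _ h) h
      have heq : univ.filter (r i) = univ.filter (r j) := by
        ext l
        simp only [mem_filter, mem_univ, true_and]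
        exact ⟨htrans _ _ _ (hsymm _ _ h), htrans _ _ _ h⟩
      simp [h, hii, hjj, heq]
    · rw [if_neg h, eq_comm]
      refine sum_eq_zero fun T _ => ?_
      by_contra hne
      simp only [mul_ite, mul_one, mul_zero, ite_eq_right_iff, not_forall] at hne
      obtain ⟨⟨hj, hjT⟩, ⟨hi, hiT⟩, -⟩ := hne
      have : j ∈ univ.filter (r i) := by rw [hiT, ← hjT]; simpa using hj
      exact h (by simpa using this)
  have : ∑ i, ∑ j, α i * α j * (if r i j then 1 else 0) = ∑ T : Finset ι,
      (∑ i, α i * (if r i i ∧ univ.filter (r i) = T then 1 else 0)) ^ 2 := by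
    simp_rw [key, sq, sum_mul_sum, mul_sum]
    symm
    rw [sum_comm]
    refine sum_congr rfl fun i _ => ?_
    rw [sum_comm]
    exact sum_congr rfl fun j _ => sum_congr rfl fun T _ => by ring
  rw [this]
  positivity

/-- A nonnegative symmetric kernel with the ultrametric inequality is positive semidefinite: it is
the integral over `t > 0` of the indicators of the relations `t ≤ K i j`, and each of these is
symmetric and transitive. -/
theorem sum_mul_ultrametric_nonneg {ι : Type*} [Fintype ι] (K : ι → ι → ℝ)
    (hK : ∀ i j, 0 ≤ K i j) (hsymm : ∀ i j, K i j = K j i)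
    (hultra : ∀ i j l, min (K i j) (K j l) ≤ K i l) (α : ι → ℝ) :
    0 ≤ ∑ i, ∑ j, α i * α j * K i j := by
  have hint (i j : ι) : MeasureTheory.Integrable
      ((Set.Ioc 0 (K i j)).indicator (1 : ℝ → ℝ)) := by
    rw [MeasureTheory.integrable_indicator_iff measurableSet_Ioc]
    exact MeasureTheory.integrableOn_const (by simp) (by simp)
  have hlayer (i j : ι) :
      K i j = ∫ t : ℝ, (Set.Ioc 0 (K i j)).indicator (1 : ℝ → ℝ) t := by
    rw [MeasureTheory.integral_indicator_one measurableSet_Ioc]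
    simp [hK i j]
  have : ∑ i, ∑ j, α i * α j * K i j = ∫ t : ℝ, ∑ i, ∑ j,
      α i * α j * (Set.Ioc 0 (K i j)).indicator (1 : ℝ → ℝ) t := by
    rw [MeasureTheory.integral_finsetSum _ fun i _ => MeasureTheory.integrable_finsetSum _
      fun j _ => (hint i j).const_mul _]
    refine sum_congr rfl fun i _ => ?_
    rw [MeasureTheory.integral_finsetSum _ fun j _ => (hint i j).const_mul _]
    refine sum_congr rfl fun j _ => ?_
    rw [MeasureTheory.integral_const_mul, ← hlayer]
  rw [this]
  refine MeasureTheory.integral_nonneg fun t => ?_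
  classical
  simp only [Set.indicator_apply, Pi.one_apply]
  refine sum_mul_indicator_nonneg (fun i j => t ∈ Set.Ioc 0 (K i j)) ?_ ?_ α
  · intro i j h
    rwa [← hsymm]
  · intro i j l h1 h2
    exact ⟨h1.1, (le_min h1.2 h2.2).trans (hultra i j l)⟩

/-! ### Truncated kernels and labels -/

/-- A family of nonnegative numbers, one of which is `k`, can be truncated at a level in `[0, k]` so
that its sum becomes `k`. -/
theorem exists_truncation_radius {ι : Type*} [Fintype ι] {k : ℝ} (hk : 0 ≤ k) (d : ι → ℝ)
    (hd : ∀ i, 0 ≤ d i) (s : ι) (hs : d s = k) :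
    ∃ r, 0 ≤ r ∧ r ≤ k ∧ ∑ i, min r (d i) = k := by
  have hcont : ContinuousOn (fun r : ℝ => ∑ i, min r (d i)) (Set.Icc 0 k) := by fun_prop
  have h0 : ∑ i, min 0 (d i) = 0 := sum_eq_zero fun i _ => min_eq_left (hd i)
  have h1 : k ≤ ∑ i, min k (d i) := by
    calc k = min k (d s) := by simp [hs]
      _ ≤ _ := single_le_sum (f := fun i => min k (d i)) (fun i _ => le_min hk (hd i))
        (mem_univ s)
  obtain ⟨r, hr, hrk⟩ := intermediate_value_Icc hk hcont (show k ∈ Set.Icc _ _ from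
    ⟨by simpa [h0] using hk, h1⟩)
  exact ⟨r, hr.1, hr.2, hrk⟩

theorem sum_min_lt_sum_min {ι : Type*} [Fintype ι] {d : ι → ℝ} {r r' : ℝ} (h : r < r') (s : ι)
    (hs : r' ≤ d s) : ∑ i, min r (d i) < ∑ i, min r' (d i) := by
  refine sum_lt_sum (fun i _ => min_le_min_right _ h.le) ⟨s, mem_univ s, ?_⟩
  rw [min_eq_left hs, min_eq_left (h.le.trans hs)]
  exact h

/-- Let `d` be an ultrametric similarity with constant diagonal `k`, and truncate each row `s` at the
level `ρ s` at which it sums to `k`. The symmetric kernel `H s t = min (d s t) (min (ρ s) (ρ t))` is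
still ultrametric and has all row sums equal to `k`. So the constant vector is an eigenvector of the
positive semidefinite form `H`, which is bounded below by its value on the projection of `α` to the
constants. -/
theorem sum_sq_le_sum_truncated {ι : Type*} [Fintype ι] {k : ℝ} (d : ι → ι → ℝ)
    (hd : ∀ s t, 0 ≤ d s t) (hsymm : ∀ s t, d s t = d t s)
    (hultra : ∀ s t u, min (d s t) (d t u) ≤ d s u) (hdiag : ∀ s, d s s = k) (ρ : ι → ℝ)
    (hρ : ∀ s, 0 ≤ ρ s) (hρk : ∀ s, ρ s ≤ k) (hsum : ∀ s, ∑ i, min (ρ s) (d s i) = k)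
    (α : ι → ℝ) :
    k * (∑ s, α s) ^ 2 ≤
      Fintype.card ι * ∑ s, ∑ t, α s * α t * min (d s t) (min (ρ s) (ρ t)) := by
  rcases isEmpty_or_nonempty ι with hι | hι
  · simp
  set H : ι → ι → ℝ := fun s t => min (d s t) (min (ρ s) (ρ t)) with hH
  have hHsymm (s t) : H s t = H t s := by simp only [hH, hsymm s t, min_comm (ρ s)]
  have hHrow (s) : ∑ t, H s t = k := by
    rw [← hsum s]
    refine sum_congr rfl fun t _ => ?_
    -- Below the level `d s t` the truncated rows of `s` and of `t` agree, by the ultrametric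
    -- inequality, so `t` cannot be truncated at a lower level than `s` is.
    have hle : min (d s t) (ρ s) ≤ ρ t := by
      by_contra! hlt
      have h1 : ∑ i, min (ρ t) (d t i) < ∑ i, min (min (d s t) (ρ s)) (d t i) :=
        sum_min_lt_sum_min hlt t (by rw [hdiag]; exact (min_le_right _ _).trans (hρk s))
      have h2 : ∑ i, min (min (d s t) (ρ s)) (d t i) ≤ ∑ i, min (ρ s) (d s i) := by
        refine sum_le_sum fun i _ => le_min ?_ ?_
        · exact (min_le_left _ _).trans (min_le_right _ _)
        · exact (min_le_min_right _ (min_le_left _ _)).trans (hultra s t i)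
      rw [hsum] at h1 h2
      exact absurd (h1.trans_le h2) (lt_irrefl _)
    simp only [hH]
    rw [← min_assoc, min_eq_left hle, min_comm]
  set A := ∑ s, α s with hA
  set m : ℝ := (Fintype.card ι : ℝ) with hm
  have hm0 : 0 < m := by rw [hm]; exact_mod_cast Fintype.card_pos
  have hpsd := sum_mul_ultrametric_nonneg H
    (fun s t => le_min (hd s t) (le_min (hρ s) (hρ t))) hHsymm (by
      intro s t u
      refine le_min ((min_le_min (min_le_left _ _) (min_le_left _ _)).trans (hultra s t u)) ?_
      refine le_min ?_ ?_
      · exact (min_le_left _ _).trans ((min_le_right _ _).trans (min_le_left _ _))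
      · exact (min_le_right _ _).trans ((min_le_right _ _).trans (min_le_right _ _)))
    (fun s => α s - A / m)
  have hexp : ∑ s, ∑ t, (α s - A / m) * (α t - A / m) * H s t =
      ∑ s, ∑ t, α s * α t * H s t - k * A ^ 2 / m := by
    have h1 : ∑ s, ∑ t, α s * H s t = k * A := by
      simp_rw [← mul_sum, hHrow, ← sum_mul]
      ring
    have h2 : ∑ s, ∑ t, α t * H s t = k * A := by
      rw [sum_comm, ← h1]
      exact sum_congr rfl fun s _ => sum_congr rfl fun t _ => by rw [hHsymm]
    have h3 : ∑ s, ∑ t, H s t = m * k := by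
      simp [hHrow, hm]
    have : ∀ s t, (α s - A / m) * (α t - A / m) * H s t = α s * α t * H s t
        - A / m * (α s * H s t) - A / m * (α t * H s t) + (A / m) ^ 2 * H s t := by
      intro s t; ring
    have h1' : ∑ s, ∑ t, A / m * (α s * H s t) = A / m * (k * A) := by simp_rw [← h1, mul_sum]
    have h2' : ∑ s, ∑ t, A / m * (α t * H s t) = A / m * (k * A) := by simp_rw [← h2, mul_sum]
    have h3' : ∑ s, ∑ t, (A / m) ^ 2 * H s t = (A / m) ^ 2 * (m * k) := by
      simp_rw [← h3, mul_sum]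
    simp_rw [this, sum_add_distrib, sum_sub_distrib, h1', h2', h3']
    field_simp
    ring
  rw [hexp, sub_nonneg, div_le_iff₀ hm0] at hpsd
  linarith

/-- If every `x ∈ X` has total similarity at least `k` to the points `y i`, then `X` can be labelled
by the `y i` in such a way that the similarity of two elements is bounded below by a kernel `H` in
their labels, where `H` satisfies the quadratic inequality of `sum_sq_le_sum_truncated`.
Each `x` is labelled by the most similar `y i`. -/
theorem exists_label_of_le_sum {ι : Type*} [Fintype ι] [Nonempty ι] {X : Finset ℤ} {k : ℝ}
    (w : ℤ → ℤ → ℝ) (hw : ∀ x y, 0 ≤ w x y) (hdiag : ∀ x, w x x = k) (hsymm : ∀ x y, w x y = w y x)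
    (hultra : ∀ x y z, min (w x y) (w y z) ≤ w x z) (y : ι → ℤ)
    (hy : ∀ x ∈ X, k ≤ ∑ i, w x (y i)) :
    ∃ (s : ℤ → ι) (H : ι → ι → ℝ), (∀ x ∈ X, ∀ x' ∈ X, H (s x) (s x') ≤ w x x') ∧
      ∀ α : ι → ℝ, k * (∑ i, α i) ^ 2 ≤
        Fintype.card ι * ∑ i, ∑ j, α i * α j * H i j := by
  have hk : 0 ≤ k := hdiag 0 ▸ hw 0 0
  choose ρ hρ hρk hsum using fun s : ι =>
    exists_truncation_radius hk (fun i => w (y s) (y i)) (fun i => hw _ _) s (hdiag _)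
  choose s hs using fun x : ℤ => Finite.exists_max fun i => w x (y i)
  refine ⟨s, fun i j => min (w (y i) (y j)) (min (ρ i) (ρ j)), ?_, fun α =>
    sum_sq_le_sum_truncated (fun i j => w (y i) (y j)) (fun _ _ => hw _ _)
      (fun _ _ => hsymm _ _) (fun _ _ _ => hultra _ _ _) (fun _ => hdiag _) ρ hρ hρk hsum α⟩
  -- Otherwise each `w x (y i)` is at most row `s x` truncated strictly below `ρ (s x)`, and the total
  -- similarity of `x` to the points `y i` is less than `k`.
  have hlabel : ∀ x ∈ X, ρ (s x) ≤ w x (y (s x)) := by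
    intro x hx
    by_contra! hlt
    have h1 := sum_min_lt_sum_min (d := fun i => w (y (s x)) (y i)) hlt (s x)
      (by simpa [hdiag] using hρk (s x))
    have h2 : ∑ i, w x (y i) ≤ ∑ i, min (w x (y (s x))) (w (y (s x)) (y i)) := by
      refine sum_le_sum fun i _ => le_min (hs x i) ?_
      refine le_trans (le_min ?_ le_rfl) (hultra (y (s x)) x (y i))
      rw [hsymm (y (s x)) x]
      exact hs x i
    rw [hsum] at h1
    exact absurd ((hy x hx).trans (h2.trans_lt h1).le) (by linarith [hy x hx])
  intro x hx x' hx'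
  refine le_trans (le_min ?_ ?_) (hultra x (y (s x)) x')
  · exact (min_le_right _ _).trans ((min_le_left _ _).trans (hlabel x hx))
  · refine le_trans (le_min (min_le_left _ _) ?_) (hultra (y (s x)) (y (s x')) x')
    rw [hsymm]
    exact (min_le_right _ _).trans ((min_le_right _ _).trans (hlabel x' hx'))

/-! ### Sums over the classes of a labelling -/

theorem sum_fiber_mul {X ι : Type*} [Fintype X] [Fintype ι] [DecidableEq ι] (s : X → ι)
    (a : X → ℝ) (F : ι → ℝ) :
    ∑ i, (∑ x, if s x = i then a x else 0) * F i = ∑ x, a x * F (s x) := by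
  simp_rw [sum_mul]
  rw [sum_comm]
  simp

/-- If the weights `a` and `b` have the same total on each fibre of the labelling `s`, then the mixed
sum of the similarities `w` inherits the lower bound of the quadratic form of `H`. -/
theorem sq_sum_le_of_fiber_sums_eq {X ι : Type*} [Fintype X] [Fintype ι] [DecidableEq ι]
    {k m : ℝ} (hm : 0 ≤ m) {s : X → ι} {H : ι → ι → ℝ} {w : X → X → ℝ}
    (hH : ∀ x x', H (s x) (s x') ≤ w x x')
    (hquad : ∀ α : ι → ℝ, k * (∑ i, α i) ^ 2 ≤ m * ∑ i, ∑ j, α i * α j * H i j)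
    {a b : X → ℝ} (ha : ∀ x, 0 ≤ a x) (hb : ∀ x, 0 ≤ b x)
    (hab : ∀ i, (∑ x, if s x = i then a x else 0) = ∑ x, if s x = i then b x else 0) :
    k * (∑ x, a x) ^ 2 ≤ m * ∑ x, ∑ x', a x * b x' * w x x' := by
  have h := hquad fun i => ∑ x, if s x = i then a x else 0
  have h1 : ∑ i, (∑ x, if s x = i then a x else 0) = ∑ x, a x := by
    simpa using sum_fiber_mul s a 1
  have h2 : ∑ i, ∑ j, (∑ x, if s x = i then a x else 0) *
      (∑ x, if s x = j then a x else 0) * H i j =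
      ∑ x, ∑ x', a x * b x' * H (s x) (s x') := by
    simp_rw [mul_assoc, ← mul_sum]
    rw [sum_fiber_mul s a fun i => ∑ j, (∑ x, if s x = j then a x else 0) * H i j]
    refine sum_congr rfl fun x _ => ?_
    simp_rw [hab]
    rw [sum_fiber_mul s b]
  rw [h1, h2] at h
  refine h.trans (mul_le_mul_of_nonneg_left ?_ hm)
  exact sum_le_sum fun x _ => sum_le_sum fun x' _ =>
    mul_le_mul_of_nonneg_left (hH x x') (mul_nonneg (ha x) (hb x'))

/-- Given labellings of `X` by `n + 1` labels, one for each element of `T`, there is a nonzero real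
function on `X` whose sum over each fibre of each labelling vanishes, as soon as
`#X > n * #T + 1`. One label of each labelling needs no condition of its own, because all labellings
share the condition that the total sum vanishes. -/
theorem exists_ne_zero_fiber_sums_eq_zero {X T : Type*} [Fintype X] [Fintype T] {n : ℕ}
    (s : T → X → Fin (n + 1)) (hcard : n * Fintype.card T + 1 < Fintype.card X) :
    ∃ c : X → ℝ, c ≠ 0 ∧ ∑ x, c x = 0 ∧ ∀ p i, (∑ x, if s p x = i then c x else 0) = 0 := by
  classical
  let M : Matrix (Option (T × Fin n)) X ℝ := fun o x => match o with
    | none => 1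
    | some (p, i) => if s p x = i.succ then 1 else 0
  have hker : LinearMap.ker (Matrix.mulVecLin M) ≠ ⊥ := by
    apply LinearMap.ker_ne_bot_of_finrank_lt
    simpa [mul_comm] using hcard
  obtain ⟨c, hc, hc0⟩ := Submodule.exists_mem_ne_zero_of_ne_bot hker
  have hM : M.mulVec c = 0 := by simpa using hc
  have hsum : ∑ x, c x = 0 := by
    simpa [Matrix.mulVec, dotProduct, M] using congrFun hM none
  have hsucc (p : T) (i : Fin n) : (∑ x, if s p x = i.succ then c x else 0) = 0 := by
    simpa [Matrix.mulVec, dotProduct, M] using congrFun hM (some (p, i))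
  refine ⟨c, hc0, hsum, fun p i => ?_⟩
  refine Fin.cases ?_ (hsucc p) i
  have h := sum_fiber_mul (s p) c 1
  simp only [Pi.one_apply, mul_one, hsum] at h
  rw [Fin.sum_univ_succ] at h
  simpa [hsucc] using h

/-! ### Capped valuations -/

/-- The exponent of `p` in `gcd (q, x - y)`: for a prime `p` and `q ≠ 0` this is the `p`-adic
valuation of `x - y`, capped at the exponent of `p` in `q`. The cap gives the diagonal a finite
value. -/
def cappedVal (q p : ℕ) (x y : ℤ) : ℕ := (q.gcd (x - y).natAbs).factorization p

theorem cappedVal_self (q p : ℕ) (x : ℤ) : cappedVal q p x x = q.factorization p := by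
  simp [cappedVal]

theorem cappedVal_comm (q p : ℕ) (x y : ℤ) : cappedVal q p x y = cappedVal q p y x := by
  simp only [cappedVal, ← neg_sub y x, Int.natAbs_neg]

theorem le_cappedVal_iff {q p : ℕ} (hq : q ≠ 0) (hp : p.Prime) (x y : ℤ) (j : ℕ) :
    j ≤ cappedVal q p x y ↔ p ^ j ∣ q ∧ (p : ℤ) ^ j ∣ x - y := by
  rw [cappedVal, ← hp.pow_dvd_iff_le_factorization (Nat.gcd_ne_zero_left hq), Nat.dvd_gcd_iff,
    ← Int.natCast_dvd, Nat.cast_pow]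

theorem min_cappedVal_le {q p : ℕ} (hq : q ≠ 0) (hp : p.Prime) (x y z : ℤ) :
    min (cappedVal q p x y) (cappedVal q p y z) ≤ cappedVal q p x z := by
  have h1 := (le_cappedVal_iff hq hp x y _).mp (min_le_left _ (cappedVal q p y z))
  have h2 := (le_cappedVal_iff hq hp y z _).mp (min_le_right (cappedVal q p x y) _)
  refine (le_cappedVal_iff hq hp x z _).mpr ⟨h1.1, ?_⟩
  simpa using dvd_add h1.2 h2.2

theorem gcd_prod_dvd_prod_gcd {ι : Type*} (s : Finset ι) (q : ℕ) (a : ι → ℕ) :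
    q.gcd (∏ i ∈ s, a i) ∣ ∏ i ∈ s, q.gcd (a i) := by
  classical
  induction s using Finset.induction_on with
  | empty => simp
  | insert i s hi ih =>
    rw [prod_insert hi, prod_insert hi]
    exact (Nat.gcd_mul_right_dvd_mul_gcd _ _ _).trans (mul_dvd_mul_left _ ih)

theorem le_sum_cappedVal {ι : Type*} [Fintype ι] {q p : ℕ} (hq : q ≠ 0) (hp : p.Prime) (x : ℤ)
    (y : ι → ℤ) (h : (p : ℤ) ^ q.factorization p ∣ ∏ i, (x - y i)) :
    q.factorization p ≤ ∑ i, cappedVal q p x (y i) := by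
  have h1 : p ^ q.factorization p ∣ ∏ i, (x - y i).natAbs := by
    have := Int.natAbs_dvd_natAbs.mpr h
    rwa [Int.natAbs_pow, Int.natAbs_natCast,
      show (∏ i, (x - y i)).natAbs = ∏ i, (x - y i).natAbs from
        map_prod Int.natAbsHom _ _] at this
  have h2 := (Nat.dvd_gcd (Nat.ordProj_dvd q p) h1).trans (gcd_prod_dvd_prod_gcd univ q _)
  have hne (i : ι) : q.gcd (x - y i).natAbs ≠ 0 := Nat.gcd_ne_zero_left hq
  rw [hp.pow_dvd_iff_le_factorization (prod_ne_zero_iff.mpr fun i _ => hne i),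
    Nat.factorization_prod fun i _ => hne i] at h2
  simpa [cappedVal] using h2

theorem sum_factorization_mul_log {q g : ℕ} (hq : q ≠ 0) (hg : g ∣ q) :
    ∑ p ∈ q.primeFactors, (g.factorization p : ℝ) * Real.log p = Real.log g := by
  have hg0 : g ≠ 0 := ne_zero_of_dvd_ne_zero hq hg
  have h := congrArg (fun m : ℕ => Real.log m) (Nat.prod_factorization_pow_eq_self hg0)
  simp only [Finsupp.prod, Nat.support_factorization, Nat.cast_prod, Nat.cast_pow] at h
  rw [← h, Real.log_prod]
  · simp_rw [Real.log_pow]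
    refine (sum_subset (Nat.primeFactors_mono hg hq) fun p _ hp => ?_).symm
    rw [← Nat.support_factorization, Finsupp.notMem_support_iff] at hp
    simp [hp]
  · intro p hp
    have := (Nat.prime_of_mem_primeFactors hp).ne_zero
    positivity

/-! ### Counting solutions with small differences -/

/-- If a polynomial of degree at most `n + 1` vanishes modulo `q` on `X`, and is nonzero modulo each
prime divisor of `q`, and the elements of `X` differ by less than `q ^ (1 / (n + 1))`, then `X` has at
most `n * ω(q) + 1` elements. -/
theorem card_le_of_pow_abs_sub_lt {n q : ℕ} (hq : q ≠ 0) {P : Polynomial ℤ}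
    (hdeg : P.natDegree ≤ n + 1) (hP : ∀ p : ℕ, p.Prime → p ∣ q → ∃ j, ¬ (p : ℤ) ∣ P.coeff j)
    {X : Finset ℤ} (hX : ∀ x ∈ X, (q : ℤ) ∣ P.eval x)
    (hlt : ∀ x ∈ X, ∀ y ∈ X, |x - y| ^ (n + 1) < q) :
    X.card ≤ n * q.primeFactors.card + 1 := by
  classical
  by_contra! hcard
  have hXne : X.Nonempty := card_pos.mp (by omega)
  have hlabel (p : q.primeFactors) : ∃ (s : ℤ → Fin (n + 1)) (H : Fin (n + 1) → Fin (n + 1) → ℝ),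
      (∀ x ∈ X, ∀ x' ∈ X, H (s x) (s x') ≤ cappedVal q p x x') ∧
      ∀ α : Fin (n + 1) → ℝ, q.factorization p * (∑ i, α i) ^ 2 ≤
        ((n + 1 : ℕ) : ℝ) * ∑ i, ∑ j, α i * α j * H i j := by
    have hp := Nat.prime_of_mem_primeFactors p.2
    obtain ⟨y, -, hy⟩ := exists_prod_sub_dvd hp (q.factorization p) hXne (n + 1) (fun _ => 1) P
      hdeg (hP p hp (Nat.dvd_of_mem_primeFactors p.2)) (fun x hx => by
        rw [one_mul]
        refine dvd_trans ?_ (hX x hx)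
        exact_mod_cast Nat.ordProj_dvd q p)
    have := exists_label_of_le_sum (X := X) (k := q.factorization p)
      (fun x y => (cappedVal q p x y : ℝ)) (fun _ _ => by positivity)
      (fun x => by rw [cappedVal_self]) (fun x y => by rw [cappedVal_comm])
      (fun x y z => by exact_mod_cast min_cappedVal_le hq hp x y z) y (fun x hx => by
        exact_mod_cast le_sum_cappedVal hq hp x y (by simpa using hy x hx))
    simpa using this
  choose s H hH hquad using hlabel
  obtain ⟨c, hc0, hcsum, hc⟩ := exists_ne_zero_fiber_sums_eq_zero (X := X)
    (T := q.primeFactors) (fun p x => s p x) (by simpa using hcard)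
  -- `a` and `b` are the positive and the negative part of `c`.
  set a : X → ℝ := fun x => max (c x) 0 with ha
  set b : X → ℝ := fun x => max (-c x) 0 with hb
  have ha0 (x) : 0 ≤ a x := le_max_right _ _
  have hb0 (x) : 0 ≤ b x := le_max_right _ _
  have hab (x) : a x = c x + b x := by
    simp only [ha, hb]
    rcases le_total (c x) 0 with h | h
    · rw [max_eq_right h, max_eq_left (by linarith)]; ring
    · rw [max_eq_left h, max_eq_right (by linarith)]; ring
  have hdisj (x) : a x * b x = 0 := by
    simp only [ha, hb]
    rcases le_total (c x) 0 with h | h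
    · rw [max_eq_right h, zero_mul]
    · rw [max_eq_right (a := -c x) (by linarith), mul_zero]
  have habsum : ∑ x, a x = ∑ x, b x := by
    simp_rw [hab, sum_add_distrib, hcsum, zero_add]
  have hApos : 0 < ∑ x, a x := by
    refine (sum_nonneg fun x _ => ha0 x).lt_of_ne fun h => hc0 ?_
    have h1 := (sum_eq_zero_iff_of_nonneg fun x _ => ha0 x).mp h.symm
    have h2 := (sum_eq_zero_iff_of_nonneg fun x _ => hb0 x).mp (habsum ▸ h.symm)
    ext x
    have := hab x
    rw [h1 x (mem_univ x), h2 x (mem_univ x)] at this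
    simpa using this.symm
  have hprime (p : q.primeFactors) : q.factorization p * (∑ x, a x) ^ 2 ≤
      ((n + 1 : ℕ) : ℝ) * ∑ x, ∑ x', a x * b x' * (cappedVal q p (x : ℤ) (x' : ℤ) : ℝ) := by
    refine sq_sum_le_of_fiber_sums_eq (s := fun x : X => s p x) (by positivity)
      (fun x x' => hH p x x.2 x' x'.2) (hquad p) ha0 hb0 fun i => ?_
    have h := hc p i
    rw [← sub_eq_zero, ← sum_sub_distrib, ← h]
    refine sum_congr rfl fun x _ => ?_
    split_ifs
    · rw [hab]; ring
    · ring
  have htotal : Real.log q * (∑ x, a x) ^ 2 ≤ ((n + 1 : ℕ) : ℝ) * ∑ x : X, ∑ x' : X,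
      a x * b x' * Real.log (q.gcd ((x : ℤ) - x').natAbs) := by
    have h := sum_le_sum fun p (_ : p ∈ (univ : Finset q.primeFactors)) =>
      mul_le_mul_of_nonneg_right (hprime p) (Real.log_natCast_nonneg (p : ℕ))
    have hl : ∑ p : q.primeFactors, (q.factorization p : ℝ) * (∑ x, a x) ^ 2 * Real.log (p : ℕ) =
        Real.log q * (∑ x, a x) ^ 2 := by
      rw [← sum_factorization_mul_log hq dvd_rfl, sum_mul, ← sum_coe_sort q.primeFactors]
      exact sum_congr rfl fun p _ => by ring
    have hr : ∑ p : q.primeFactors, ((n + 1 : ℕ) : ℝ) * (∑ x, ∑ x', a x * b x' *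
        (cappedVal q p (x : ℤ) (x' : ℤ) : ℝ)) * Real.log (p : ℕ) =
        ((n + 1 : ℕ) : ℝ) * ∑ x : X, ∑ x' : X,
          a x * b x' * Real.log (q.gcd ((x : ℤ) - x').natAbs) := by
      simp_rw [mul_sum, sum_mul]
      rw [sum_comm]
      refine sum_congr rfl fun x _ => ?_
      rw [sum_comm]
      refine sum_congr rfl fun x' _ => ?_
      rw [← sum_factorization_mul_log hq (Nat.gcd_dvd_left _ _), ← sum_coe_sort q.primeFactors,
        mul_sum, mul_sum]
      exact sum_congr rfl fun p _ => by rw [cappedVal]; ring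
    rwa [hl, hr] at h
  -- The upper bound: where `a x * b x'` is nonzero, `x ≠ x'` and `gcd (q, x - x') ≤ |x - x'|`.
  have hterm (x x' : X) (hne : a x * b x' ≠ 0) :
      ((n + 1 : ℕ) : ℝ) * Real.log (q.gcd ((x : ℤ) - x').natAbs) < Real.log q := by
    have hxx : (x : ℤ) - x' ≠ 0 := by
      intro h
      have : x = x' := Subtype.ext (sub_eq_zero.mp h)
      exact hne (this ▸ hdisj x)
    have h1 : q.gcd ((x : ℤ) - x').natAbs ≤ ((x : ℤ) - x').natAbs :=
      Nat.gcd_le_right _ (Int.natAbs_pos.mpr hxx)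
    have h2 : ((x : ℤ) - x').natAbs ^ (n + 1) < q := by
      have := hlt x x.2 x' x'.2
      rw [Int.abs_eq_natAbs] at this
      exact_mod_cast this
    rw [← Real.log_pow]
    have hpos := Nat.gcd_pos_of_pos_left ((x : ℤ) - x').natAbs (Nat.pos_of_ne_zero hq)
    refine Real.log_lt_log (by positivity) ?_
    exact_mod_cast (Nat.pow_le_pow_left h1 _).trans_lt h2
  have hstrict : ((n + 1 : ℕ) : ℝ) * ∑ x : X, ∑ x' : X,
      a x * b x' * Real.log (q.gcd ((x : ℤ) - x').natAbs) < Real.log q * (∑ x, a x) ^ 2 := by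
    have hexp : Real.log q * (∑ x, a x) ^ 2 = ∑ x : X, ∑ x' : X, a x * b x' * Real.log q := by
      nth_rw 1 [sq]
      nth_rw 2 [habsum]
      rw [sum_mul_sum, mul_sum]
      exact sum_congr rfl fun x _ => by rw [mul_sum]; exact sum_congr rfl fun _ _ => by ring
    rw [hexp, mul_sum]
    simp_rw [mul_sum]
    have hle (x x' : X) : ((n + 1 : ℕ) : ℝ) * (a x * b x' *
        Real.log (q.gcd ((x : ℤ) - x').natAbs)) ≤ a x * b x' * Real.log q := by
      by_cases hne : a x * b x' = 0
      · simp [hne]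
      · rw [mul_left_comm]
        exact mul_le_mul_of_nonneg_left (hterm x x' hne).le (mul_nonneg (ha0 x) (hb0 x'))
    obtain ⟨x, -, hx⟩ := exists_ne_zero_of_sum_ne_zero hApos.ne'
    obtain ⟨x', -, hx'⟩ := exists_ne_zero_of_sum_ne_zero (habsum ▸ hApos.ne')
    refine sum_lt_sum (fun x _ => sum_le_sum fun x' _ => hle x x')
      ⟨x, mem_univ x, sum_lt_sum (fun x' _ => hle x x') ⟨x', mem_univ x', ?_⟩⟩
    rw [mul_left_comm]
    exact mul_lt_mul_of_pos_left (hterm x x' (mul_ne_zero hx hx'))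
      (mul_pos ((ha0 x).lt_of_ne' hx) ((hb0 x').lt_of_ne' hx'))
  exact absurd htotal (not_le.mpr hstrict)

/-- With differences allowed to equal `q ^ (1 / (n + 1))`, removing the largest element makes all
differences strictly smaller. -/
theorem card_le_of_pow_abs_sub_le {n q : ℕ} (hq : q ≠ 0) {P : Polynomial ℤ}
    (hdeg : P.natDegree ≤ n + 1) (hP : ∀ p : ℕ, p.Prime → p ∣ q → ∃ j, ¬ (p : ℤ) ∣ P.coeff j)
    {X : Finset ℤ} (hX : ∀ x ∈ X, (q : ℤ) ∣ P.eval x)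
    (hle : ∀ x ∈ X, ∀ y ∈ X, |x - y| ^ (n + 1) ≤ q) :
    X.card ≤ n * q.primeFactors.card + 2 := by
  rcases X.eq_empty_or_nonempty with rfl | hne
  · simp
  have hM := X.max'_mem hne
  have key : ∀ x ∈ X.erase (X.max' hne), ∀ y ∈ X.erase (X.max' hne), x ≤ y →
      |x - y| ^ (n + 1) < q := by
    intro x hx y hy hxy
    refine lt_of_lt_of_le ?_ (hle _ (mem_of_mem_erase hx) _ hM)
    have h1 := lt_max'_of_mem_erase_max' X hne hy
    refine pow_lt_pow_left₀ ?_ (abs_nonneg _) (by omega)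
    rw [abs_sub_comm x, abs_sub_comm x, abs_of_nonneg (by omega), abs_of_nonneg (by omega)]
    omega
  have := card_le_of_pow_abs_sub_lt hq hdeg hP (X := X.erase (X.max' hne))
    (fun x hx => hX x (mem_of_mem_erase hx)) (fun x hx y hy => by
      rcases le_total x y with h | h
      · exact key x hx y hy h
      · rw [abs_sub_comm]
        exact key y hy x hx h)
  rw [card_erase_of_mem hM] at this
  omega

/-- The case of degree two and a prime power modulus, where `card_le_of_pow_abs_sub_le` gives one
too many. For the two points `y 0`, `y 1` of `exists_prod_sub_dvd`, the modulus divides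
`(x - y 0) * (x - y 1)`, which is too small unless both factors are extremal. -/
theorem card_le_two_of_natDegree_le_two {p k : ℕ} (hp : p.Prime) {P : Polynomial ℤ}
    (hdeg : P.natDegree ≤ 2) (hP : ∃ j, ¬ (p : ℤ) ∣ P.coeff j)
    {X : Finset ℤ} (hX : ∀ x ∈ X, (p : ℤ) ^ k ∣ P.eval x)
    (hle : ∀ x ∈ X, ∀ y ∈ X, |x - y| ^ 2 ≤ (p : ℤ) ^ k) :
    X.card ≤ 2 := by
  rcases X.eq_empty_or_nonempty with rfl | hne
  · simp
  obtain ⟨y, hyX, hy⟩ := exists_prod_sub_dvd hp k hne 2 (fun _ => 1) P hdeg hP (by simpa using hX)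
  simp only [one_mul, Fin.prod_univ_two] at hy
  have hpk : 0 < (p : ℤ) ^ k := pow_pos (by exact_mod_cast hp.pos) k
  have hnot : ∀ x ∈ X, x ≠ y 0 → x ≠ y 1 → ¬ |(x - y 0) * (x - y 1)| < (p : ℤ) ^ k := by
    intro x hx h0 h1 hlt
    exact mul_ne_zero (sub_ne_zero.mpr h0) (sub_ne_zero.mpr h1)
      (Int.eq_zero_of_abs_lt_dvd (hy x hx) hlt)
  have hends : ∀ x ∈ X, x ≠ y 0 → x ≠ y 1 →
      y 0 = y 1 ∧ (x - y 0) ^ 2 = (p : ℤ) ^ k := by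
    intro x hx h0 h1
    have h := not_lt.mp (hnot x hx h0 h1)
    have a0 := hle x hx _ (hyX 0)
    have a1 := hle x hx _ (hyX 1)
    have a2 := hle _ (hyX 0) _ (hyX 1)
    rw [sq_abs] at a0 a1 a2
    rw [← abs_of_pos hpk] at h
    have hsq : ((p : ℤ) ^ k) ^ 2 ≤ (x - y 0) ^ 2 * (x - y 1) ^ 2 := by
      rw [← mul_pow]
      exact sq_le_sq.mpr h
    have e0 : (x - y 0) ^ 2 = (p : ℤ) ^ k := by nlinarith
    have e1 : (x - y 1) ^ 2 = (p : ℤ) ^ k := by nlinarith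
    refine ⟨?_, e0⟩
    rcases sq_eq_sq_iff_eq_or_eq_neg.mp (e0.trans e1.symm) with h2 | h2
    · linarith
    · have : y 0 - y 1 = -2 * (x - y 0) := by linarith
      rw [this, mul_pow, e0] at a2
      linarith
  by_contra! hcard
  obtain ⟨x, hx, hxy⟩ := exists_mem_notMem_of_card_lt_card
    (show #{y 0, y 1} < #X from card_le_two.trans_lt hcard)
  simp only [mem_insert, mem_singleton, not_or] at hxy
  obtain ⟨hy01, ex⟩ := hends x hx hxy.1 hxy.2
  obtain ⟨z, hz, hzy⟩ := exists_mem_notMem_of_card_lt_card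
    (show #{x, y 0} < #X from card_le_two.trans_lt hcard)
  simp only [mem_insert, mem_singleton, not_or] at hzy
  obtain ⟨-, ez⟩ := hends z hz hzy.2 (hy01 ▸ hzy.2)
  rcases sq_eq_sq_iff_eq_or_eq_neg.mp (ex.trans ez.symm) with h | h
  · exact hzy.1 (by linarith)
  · have hxz : x - z = 2 * (x - y 0) := by linarith
    have := hle x hx z hz
    rw [sq_abs, hxz, mul_pow, ex] at this
    linarith

/-! ### Solutions in an interval -/

theorem exists_not_dvd_coeff_of_gcd_content {P : Polynomial ℤ} {q : ℕ}
    (hgcd : Int.gcd P.content (q : ℤ) = 1) {p : ℕ} (hp : p.Prime) (hpq : p ∣ q) :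
    ∃ j, ¬ (p : ℤ) ∣ P.coeff j := by
  by_contra! h
  have h1 : (p : ℤ) ∣ P.content :=
    Polynomial.dvd_content_iff_C_dvd.mpr ((Polynomial.C_dvd_iff_dvd_coeff _ _).mpr h)
  have h2 : (p : ℤ) ∣ Int.gcd P.content (q : ℤ) :=
    Int.dvd_coe_gcd h1 (by exact_mod_cast hpq)
  rw [hgcd] at h2
  exact hp.one_lt.ne' (by simpa using Int.natCast_dvd_natCast.mp h2)

theorem card_le_two_mul_sq_mul {n q : ℕ} (hn : 1 ≤ n) (hq : 2 ≤ q) {P : Polynomial ℤ}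
    (hdeg : P.natDegree ≤ n + 1) (hP : ∀ p : ℕ, p.Prime → p ∣ q → ∃ j, ¬ (p : ℤ) ∣ P.coeff j)
    {X : Finset ℤ} (hX : ∀ x ∈ X, (q : ℤ) ∣ P.eval x)
    (hle : ∀ x ∈ X, ∀ y ∈ X, |x - y| ^ (n + 1) ≤ q) :
    X.card ≤ 2 * n ^ 2 * q.primeFactors.card := by
  have h := card_le_of_pow_abs_sub_le (by omega) hdeg hP hX hle
  have hω : 1 ≤ q.primeFactors.card :=
    card_pos.mpr (Nat.nonempty_primeFactors.mpr (by omega))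
  by_cases h1 : n = 1 ∧ q.primeFactors.card = 1
  · obtain ⟨rfl, hc⟩ := h1
    have hpp : IsPrimePow q := by
      rwa [isPrimePow_iff_card_primeFactors_eq_one]
    obtain ⟨p, k, hp, hk, rfl⟩ := (isPrimePow_nat_iff q).mp hpp
    rw [hc]
    refine card_le_two_of_natDegree_le_two hp hdeg (hP p hp (dvd_pow_self p hk.ne')) (k := k) ?_ ?_
    · simpa using hX
    · simpa using hle
  · refine h.trans ?_
    set w := q.primeFactors.card
    have h3 : 2 ≤ n * w := by
      rcases Nat.lt_or_ge n 2 with hn2 | hn2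
      · have : n = 1 := by omega
        subst this
        omega
      · nlinarith
    nlinarith

theorem abs_sub_pow_le_of_volume_le {n q : ℕ} (hn : n ≠ 0) {I : Set ℝ} (hI : I.OrdConnected)
    (hlen : MeasureTheory.volume I ≤ ENNReal.ofReal ((q : ℝ) ^ (1 / (n : ℝ)))) {x y : ℤ}
    (hx : (x : ℝ) ∈ I) (hy : (y : ℝ) ∈ I) : |x - y| ^ n ≤ (q : ℤ) := by
  have hsub := (MeasureTheory.measure_mono (hI.uIcc_subset hx hy)).trans hlen
  rw [Real.volume_interval, ENNReal.ofReal_le_ofReal_iff (by positivity)] at hsub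
  have h := pow_le_pow_left₀ (abs_nonneg _) hsub n
  rw [one_div, Real.rpow_inv_natCast_pow (by positivity) hn, abs_sub_comm] at h
  exact_mod_cast h

theorem theorem3 (n : ℕ) (hn : 2 ≤ n) (P : Polynomial ℤ) (hP : P.natDegree = n)
    (q : ℕ) (hq : 2 ≤ q) (hgcd : Int.gcd P.content (q : ℤ) = 1)
    (I : Set ℝ) (hI : I.OrdConnected)
    (hlen : MeasureTheory.volume I ≤ ENNReal.ofReal ((q : ℝ) ^ (1 / (n : ℝ)))) :
    {x : ℤ | (x : ℝ) ∈ I ∧ P.eval x ≡ 0 [ZMOD (q : ℤ)]}.Finite ∧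
      (({x : ℤ | (x : ℝ) ∈ I ∧ P.eval x ≡ 0 [ZMOD (q : ℤ)]}.ncard : ℕ) : ℤ) ≤
        2 * ((n : ℤ) - 1) ^ 2 * (ArithmeticFunction.cardDistinctFactors q : ℤ) := by
  set S := {x : ℤ | (x : ℝ) ∈ I ∧ P.eval x ≡ 0 [ZMOD (q : ℤ)]} with hS
  have hdiff : ∀ x ∈ S, ∀ y ∈ S, |x - y| ^ n ≤ (q : ℤ) := fun x hx y hy =>
    abs_sub_pow_le_of_volume_le (by omega) hI hlen hx.1 hy.1
  have hfin : S.Finite := by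
    rcases S.eq_empty_or_nonempty with h | ⟨x, hx⟩
    · simp [h]
    · refine (Set.finite_Icc (x - q) (x + q)).subset fun y hy => ?_
      have h1 : |y - x| ≤ q := by
        rcases (abs_nonneg (y - x)).eq_or_lt with h | h
        · rw [← h]; positivity
        · exact (le_self_pow₀ h (by omega)).trans (hdiff y hy x hx)
      rw [abs_le] at h1
      exact ⟨by linarith, by linarith⟩
  refine ⟨hfin, ?_⟩
  obtain ⟨m, rfl⟩ : ∃ m, n = m + 1 := ⟨n - 1, by omega⟩
  have h := card_le_two_mul_sq_mul (by omega) hq hP.le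
    (fun p hp hpq => exists_not_dvd_coeff_of_gcd_content hgcd hp hpq) (X := hfin.toFinset)
    (fun x hx => Int.modEq_zero_iff_dvd.mp (hfin.mem_toFinset.mp hx).2)
    (fun x hx y hy => hdiff x (hfin.mem_toFinset.mp hx) y (hfin.mem_toFinset.mp hy))
  rw [← Set.ncard_eq_toFinset_card S hfin] at h
  rw [ArithmeticFunction.cardDistinctFactors_apply, ← List.card_toFinset]
  push_cast
  rw [add_sub_cancel_right]
  exact_mod_cast h
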